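/- Work in formal power series in $z$ over $\mathbb{Q}[t][[x_1,x_2,\dots]]$. For a finite digraph $\overrightarrow{G}=(V,E)$ let $$X_{\overrightarrow{G}}(\mathbf{x},t)=\sum_{\kappa}t^{\mathrm{asc}(\kappa)}\prod_{v\in V}x_{\kappa(v)},$$ where $\kappa$ ranges over all proper colorings $\kappa:V\to\{1,2,3,\dots\}$ of the underlying undirected graph of $\overrightarrow{G}$, and $\mathrm{asc}(\kappa)$ is the number of directed edges $(u,v)\in E$ with $\kappa(u)<\kappa(v)$. For $n\ge 2$ let $\overrightarrow{C_n}$ be the directed cycle with vertices $v_1,\dots,v_n$ and edges $(v_i,v_{i+1})$ for $1\le i<n$ together with $(v_n,v_1)$. Let $e_k=e_k(\mathbf{x})$ be the $k$-th elementary symmetric function in $x_1,x_2,\dots$ and let $[n]_t=1+t+\cdots+t^{n-1}$. **Theorem.** $$\sum_{n\ge2}X_{\overrightarrow{C_n}}(\mathbf{x},t)\,z^n=\frac{t\sum_{k\ge2}k\,[k-1]_t\,e_k(\mathbf{x})\,z^k}{1-t\sum_{k\ge2}[k-1]_t\,e_k(\mathbf{x})\,z^k},$$ where the denominator is an invertible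 formal power series. -/

import Mathlib

open Polynomial

noncomputable section

namespace ChromQSym

/-- A coloring of the vertices of a digraph by positive integers is proper if it is a proper
coloring of the underlying undirected graph. -/
def IsProper {V : Type} (G : Digraph V) (κ : V → ℕ+) : Prop :=
  ∀ u v : V, G.toSimpleGraphInclusive.Adj u v → κ u ≠ κ v

open Classical in
/-- The number of directed edges `(u, v)` with `κ u < κ v`. -/
def asc {V : Type} [Fintype V] (G : Digraph V) (κ : V → ℕ+) : ℕ :=
  (Finset.univ.filter fun e : V × V => G.Adj e.1 e.2 ∧ κ e.1 < κ e.2).card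

/-- The exponent vector of the monomial `x_κ = ∏ v, x_{κ v}`. -/
def monoExp {V : Type} [Fintype V] (κ : V → ℕ+) : ℕ+ →₀ ℕ :=
  ∑ v : V, Finsupp.single (κ v) 1

open Classical in
/-- The finite set of the proper colorings `κ` of `G` with `x_κ = x^m`. Such a coloring only uses
colors from the support of `m`; see `mem_properColorings`. -/
def properColorings {V : Type} [Fintype V] (G : Digraph V) (m : ℕ+ →₀ ℕ) : Finset (V → ℕ+) :=
  (Fintype.piFinset fun _ : V => m.support).filter fun κ => IsProper G κ ∧ monoExp κ = m

theorem mem_properColorings {V : Type} [Fintype V] (G : Digraph V) (m : ℕ+ →₀ ℕ) (κ : V → ℕ+) :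
    κ ∈ properColorings G m ↔ IsProper G κ ∧ monoExp κ = m := by
  classical
  simp only [properColorings, Finset.mem_filter, Fintype.mem_piFinset, and_iff_right_iff_imp]
  rintro ⟨-, rfl⟩ v
  rw [Finsupp.mem_support_iff, monoExp, Finsupp.finsetSum_apply]
  intro h
  have := (Finset.sum_eq_zero_iff.mp h) v (Finset.mem_univ v)
  simp at this

/-- The chromatic quasisymmetric function `X_G(x, t) = ∑_κ t^{asc κ} x_κ`, summed over all proper
colorings `κ : V → {1, 2, 3, …}`, as a formal power series in `x₁, x₂, …` with coefficients in
`ℚ[t]`: the coefficient of `x^m` is the sum of `t^{asc κ}` over the finitely many `κ` with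
`x_κ = x^m`. The variable `t` is `Polynomial.X`. -/
def chromQSym {V : Type} [Fintype V] (G : Digraph V) : MvPowerSeries ℕ+ ℚ[X] :=
  fun m => ∑ κ ∈ properColorings G m, (X : ℚ[X]) ^ asc G κ

open Classical in
/-- The elementary symmetric function `e_k(x₁, x₂, …) = ∑_{|S| = k} ∏_{i ∈ S} x_i`: distinct sets
`S` give distinct monomials, so every coefficient is `1` or `0`. -/
def esymm (k : ℕ) : MvPowerSeries ℕ+ ℚ[X] :=
  fun m => if ∃ S : Finset ℕ+, S.card = k ∧ m = ∑ i ∈ S, Finsupp.single i 1 then 1 else 0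

/-- The variable `t`, as a constant of `ℚ[t]⟦x₁, x₂, …⟧`. -/
def tVar : MvPowerSeries ℕ+ ℚ[X] := MvPowerSeries.C (X : ℚ[X])

/-- `[n]_t = 1 + t + ⋯ + t^{n-1}`. -/
def tInt (n : ℕ) : MvPowerSeries ℕ+ ℚ[X] := ∑ i ∈ Finset.range n, tVar ^ i

/-- The directed cycle on the vertices `0, …, n - 1`, with the edges `(i, i + 1)` for
`i + 1 < n` and the edge `(n - 1, 0)`. -/
def directedCycle (n : ℕ) : Digraph (Fin n) where
  Adj i j := i.val + 1 = j.val ∨ (i.val + 1 = n ∧ j.val = 0)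

/-- `∑_{n ≥ 2} a_n z^n`, a power series in `z` over `ℚ[t]⟦x₁, x₂, …⟧`. -/
def genFrom2 (a : ℕ → MvPowerSeries ℕ+ ℚ[X]) : PowerSeries (MvPowerSeries ℕ+ ℚ[X]) :=
  PowerSeries.mk fun n => if 2 ≤ n then a n else 0

end ChromQSym

end

/-! The proof uses a transfer matrix. With colors confined to a finite set, let `M` have `(i, j)`
entry `t x_j` for `i < j`, `x_j` for `i > j`, and `0` for `i = j`. Proper colorings of the cycle are
closed walks of nonzero weight, so its chromatic function is `tr (M ^ n)`, and Jacobi's formula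
gives `∑ tr (M ^ n) z ^ n = -z D' / D` with `D = det (1 - z M)`. A rank-one interpolation
(`det_interpolate`) yields `(t - 1) D = t ∏ (1 + x_j z) - ∏ (1 + t x_j z)`. Its `z ^ k` coefficient
is `(t - t ^ k) e_k`, so `D` is the stated denominator and `-z D'` the numerator. Finite color sets
suffice by `ext_restrictVars`. -/

/-! ### Jacobi's formula and traces of powers -/

theorem derivation_prod {R A ι : Type*} [CommRing R] [CommRing A] [Algebra R A] [DecidableEq ι]
    (D : Derivation R A A) (s : Finset ι) (f : ι → A) :
    D (∏ i ∈ s, f i) = ∑ i ∈ s, D (f i) * ∏ j ∈ s.erase i, f j := by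
  induction s using Finset.induction_on with
  | empty => simp
  | insert a s ha ih =>
    rw [Finset.prod_insert ha, Derivation.leibniz, ih, Finset.sum_insert ha,
      Finset.erase_insert ha, smul_eq_mul, smul_eq_mul, Finset.mul_sum, mul_comm (∏ i ∈ s, f i),
      add_comm]
    refine congrArg _ (Finset.sum_congr rfl fun i hi => ?_)
    have hia : a ≠ i := fun h => ha (h ▸ hi)
    rw [Finset.erase_insert_of_ne hia, Finset.prod_insert (by simp [ha])]
    ring

/-- Jacobi's formula for the derivative of a determinant. -/
theorem derivation_det {R A ι : Type*} [CommRing R] [CommRing A] [Algebra R A] [DecidableEq ι]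
    [Fintype ι] (D : Derivation R A A) (M : Matrix ι ι A) :
    D M.det = (M.adjugate * M.map D).trace := by
  have key (i : ι) : (M.adjugate * M.map D) i i = (M.updateCol i fun j => D (M j i)).det := by
    rw [← Matrix.cramer_apply, Matrix.cramer_eq_adjugate_mulVec]
    rfl
  simp only [Matrix.trace, Matrix.diag_apply, key, Matrix.det_apply', map_sum]
  rw [Finset.sum_comm]
  refine Finset.sum_congr rfl fun σ _ => ?_
  rw [Derivation.leibniz, Derivation.map_intCast, smul_zero, add_zero, smul_eq_mul,
    derivation_prod, Finset.mul_sum]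
  refine Finset.sum_congr rfl fun i _ => ?_
  rw [← Finset.mul_prod_erase _ _ (Finset.mem_univ i), Matrix.updateCol_self]
  refine congrArg _ (congrArg _ (Finset.prod_congr rfl fun j hj => ?_))
  rw [Matrix.updateCol_ne (Finset.ne_of_mem_erase hj)]

/-- The characteristic matrix `1 - z M` over power series in `z`. -/
noncomputable def oneSubXSmul {R ι : Type*} [CommRing R] [DecidableEq ι] (M : Matrix ι ι R) :
    Matrix ι ι (PowerSeries R) :=
  1 - (PowerSeries.X : PowerSeries R) • M.map PowerSeries.C

/-- The generating function `∑ z^n tr (M^n)` of the traces of powers is a negative logarithmic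
derivative. -/
theorem mk_trace_pow_mul_det {R ι : Type*} [CommRing R] [DecidableEq ι] [Fintype ι]
    (M : Matrix ι ι R) :
    (PowerSeries.mk fun n => if n = 0 then 0 else (M ^ n).trace) * (oneSubXSmul M).det =
      -(PowerSeries.X * PowerSeries.derivative R (oneSubXSmul M).det) := by
  set T : Matrix ι ι (PowerSeries R) := fun i j => PowerSeries.mk fun n => (M ^ n) i j with hT
  have hTa (i j : ι) (n : ℕ) : PowerSeries.coeff n (T i j) = (M ^ n) i j := by simp [hT]
  -- `T` is the geometric series `∑ z ^ n M ^ n`.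
  have hTM : T * oneSubXSmul M = 1 := by
    ext i j n
    have : (T * M.map PowerSeries.C) i j = PowerSeries.mk fun n => (M ^ (n + 1)) i j := by
      ext n
      simp [Matrix.mul_apply, pow_succ, hTa]
    rw [oneSubXSmul, mul_sub, mul_one, Matrix.mul_smul, Matrix.sub_apply, Matrix.smul_apply, this,
      smul_eq_mul]
    cases n with
    | zero =>
      rw [map_sub, hTa]
      by_cases h : i = j <;> simp [Matrix.one_apply, h]
    | succ n =>
      by_cases h : i = j <;>
        simp [hTa, Matrix.one_apply, h, PowerSeries.coeff_succ_X_mul, PowerSeries.coeff_one]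
  have hadj : (oneSubXSmul M).adjugate = (oneSubXSmul M).det • T := by
    calc _ = T * oneSubXSmul M * (oneSubXSmul M).adjugate := by rw [hTM, one_mul]
      _ = _ := by rw [mul_assoc, Matrix.mul_adjugate, Matrix.mul_smul, mul_one]
  have hD : (oneSubXSmul M).map (PowerSeries.derivative R) = -M.map PowerSeries.C := by
    ext1 i j
    by_cases h : i = j <;>
      simp [oneSubXSmul, h, Derivation.leibniz]
  rw [derivation_det, hadj, hD, Matrix.smul_mul, Matrix.trace_smul, mul_neg, Matrix.trace_neg,
    smul_eq_mul, mul_neg, mul_neg, neg_neg, mul_left_comm, mul_comm]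
  congr 1
  ext n
  cases n with
  | zero => simp
  | succ n =>
    simp [PowerSeries.coeff_succ_X_mul, Matrix.trace, Matrix.mul_apply, hTa, pow_succ]

/-! ### The characteristic determinant -/

/-- By the matrix determinant lemma `det (A + s u vᵀ)` is affine in `s`, so its values at `s = a`
and `s = b` determine the one at `s = 0`. -/
theorem det_interpolate {R ι : Type*} [CommRing R] [DecidableEq ι] [Fintype ι]
    (A : Matrix ι ι R) (hA : IsUnit A.det) (u v : ι → R) (a b : R) :
    (a - b) * A.det = a * (A + Matrix.of fun i j => b * u i * v j).det -
      b * (A + Matrix.of fun i j => a * u i * v j).det := by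
  have key (s : R) : (A + Matrix.of fun i j => s * u i * v j).det =
      A.det * (1 + s * (Matrix.replicateRow Unit v * A⁻¹ * Matrix.replicateCol Unit u) () ()) := by
    have : (Matrix.of fun i j => s * u i * v j) =
        Matrix.replicateCol Unit (s • u) * Matrix.replicateRow Unit v := by
      ext i j
      simp [Matrix.mul_apply]
    rw [this, Matrix.det_add_replicateCol_mul_replicateRow (ι := Unit) hA, Matrix.det_unique (n := Unit)]
    congr 1
    simp [Matrix.mul_apply, Finset.mul_sum, mul_comm]
  rw [key, key]
  ring

/-- The matrix with entries `t * x j` above the diagonal, `x j` below it, and `0` on it. -/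
def ascMatrix {R ι : Type*} [CommRing R] [LinearOrder ι] (t : R) (x : ι → R) : Matrix ι ι R :=
  Matrix.of fun i j => x j * if i < j then t else if j < i then 1 else 0

/-- Adding `z x_j` to every entry of column `j` of `1 - z M` clears the part below the diagonal;
adding `t z x_j` clears the part above. Both determinants are then products of diagonal entries. -/
theorem sub_one_mul_det_ascMatrix {R ι : Type*} [CommRing R] [LinearOrder ι]
    [DecidableEq ι] [Fintype ι] (t : R) (x : ι → R) :
    (PowerSeries.C t - 1) * (oneSubXSmul (ascMatrix t x)).det =
      PowerSeries.C t * ∏ j, (1 + PowerSeries.C (x j) * PowerSeries.X) -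
        ∏ j, (1 + PowerSeries.C (t * x j) * PowerSeries.X) := by
  set A := oneSubXSmul (ascMatrix t x) with hAdef
  have hA : IsUnit A.det := by
    rw [PowerSeries.isUnit_iff_constantCoeff, RingHom.map_det]
    have : (PowerSeries.constantCoeff (R := R)).mapMatrix A = 1 := by
      ext i j
      by_cases h : i = j <;> simp [hAdef, oneSubXSmul, Matrix.one_apply, h]
    simp [this]
  have h := det_interpolate A hA (fun _ => 1) (fun j => PowerSeries.C (x j))
    (PowerSeries.C t * PowerSeries.X) PowerSeries.X
  have h1 : (A + Matrix.of fun i j => PowerSeries.X * 1 * PowerSeries.C (x j)).det =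
      ∏ j, (1 + PowerSeries.C (x j) * PowerSeries.X) := by
    rw [Matrix.det_of_isUpperTriangular]
    · simp [hAdef, oneSubXSmul, ascMatrix, mul_comm]
    · intro i j hij
      have hij : j < i := hij
      simp [hAdef, oneSubXSmul, ascMatrix, hij, hij.not_gt, hij.ne']
  have h2 : (A + Matrix.of fun i j =>
      PowerSeries.C t * PowerSeries.X * 1 * PowerSeries.C (x j)).det =
      ∏ j, (1 + PowerSeries.C (t * x j) * PowerSeries.X) := by
    rw [Matrix.det_of_isLowerTriangular]
    · simp [hAdef, oneSubXSmul, ascMatrix, mul_comm, mul_left_comm]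
    · intro i j hij
      have hij : i < j := hij
      simp [hAdef, oneSubXSmul, ascMatrix, hij, hij.ne]
      ring
  rw [h1, h2] at h
  -- The nodes `t z` and `z` leave a common factor `z` in `h`.
  refine PowerSeries.X_mul_cancel ?_
  linear_combination h

/-! ### Walks and elementary symmetric sums -/

theorem pow_mulVec_eq_sum_walks {R ι : Type*} [CommRing R] [DecidableEq ι] [Fintype ι]
    (M : Matrix ι ι R) (v : ι → R) (n : ℕ) (a : ι) :
    ((M ^ n).mulVec v) a = ∑ κ : Fin n → ι,
      (∏ i : Fin n, M ((Fin.cons a κ : Fin (n + 1) → ι) i.castSucc)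
        ((Fin.cons a κ : Fin (n + 1) → ι) i.succ)) *
        v ((Fin.cons a κ : Fin (n + 1) → ι) (Fin.last n)) := by
  induction n generalizing a with
  | zero => simp
  | succ n ih =>
    rw [pow_succ', ← Matrix.mulVec_mulVec, Matrix.mulVec, dotProduct,
      ← (Fin.consEquiv fun _ => ι).sum_comp, Fintype.sum_prod_type]
    refine Finset.sum_congr rfl fun b _ => ?_
    rw [ih, Finset.mul_sum]
    refine Finset.sum_congr rfl fun κ _ => ?_
    rw [Fin.prod_univ_succ, ← mul_assoc]
    rfl

/-- The trace of a power is a sum over closed walks. -/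
theorem trace_pow_eq_sum_closed_walks {R ι : Type*} [CommRing R] [DecidableEq ι] [Fintype ι]
    (M : Matrix ι ι R) (n : ℕ) :
    (M ^ (n + 1)).trace = ∑ κ : Fin (n + 1) → ι, ∏ i, M (κ i) (κ (i + 1)) := by
  rw [← (Fin.consEquiv fun _ => ι).sum_comp, Fintype.sum_prod_type, Matrix.trace]
  refine Finset.sum_congr rfl fun a _ => ?_
  -- The step that closes the walk at `a` becomes the weight `v` of the end point.
  have : (M ^ (n + 1)).diag a = ((M ^ n).mulVec fun b => M b a) a := by
    rw [pow_succ, Matrix.diag_apply, Matrix.mul_apply]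
    rfl
  rw [this, pow_mulVec_eq_sum_walks]
  refine Finset.sum_congr rfl fun κ _ => ?_
  simp [Fin.prod_univ_castSucc, Fin.consEquiv, Fin.coeSucc_eq_succ]

theorem coeff_prod_one_add_C_mul_X {R ι : Type*} [CommRing R] (s : Finset ι) (a : R) (x : ι → R)
    (k : ℕ) : PowerSeries.coeff k (∏ j ∈ s, (1 + PowerSeries.C (a * x j) * PowerSeries.X)) =
      a ^ k * ∑ S ∈ s.powersetCard k, ∏ i ∈ S, x i := by
  rw [Finset.prod_one_add, map_sum, Finset.mul_sum, Finset.powersetCard_eq_filter,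
    Finset.sum_filter]
  refine Finset.sum_congr rfl fun S _ => ?_
  rw [Finset.prod_mul_distrib, ← map_prod, Finset.prod_const, PowerSeries.coeff_C_mul,
    PowerSeries.coeff_X_pow, Finset.prod_mul_distrib, Finset.prod_const]
  by_cases h : S.card = k
  · simp [h]
  · simp [h, Ne.symm h]

/-! ### Restriction to finitely many variables -/

namespace ChromQSym

/-- Set the variables with index outside `s` to zero. -/
noncomputable def restrictVars (s : Finset ℕ+) : MvPowerSeries ℕ+ ℚ[X] →+* MvPowerSeries ℕ+ ℚ[X] :=
  MvPowerSeries.rescale fun i => if i ∈ s then 1 else 0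

theorem coeff_restrictVars (s : Finset ℕ+) (f : MvPowerSeries ℕ+ ℚ[X]) (m : ℕ+ →₀ ℕ) :
    MvPowerSeries.coeff m (restrictVars s f) =
      if m.support ⊆ s then MvPowerSeries.coeff m f else 0 := by
  rw [restrictVars, MvPowerSeries.coeff_rescale, Finsupp.prod]
  split_ifs with h
  · rw [Finset.prod_eq_one, one_mul]
    intro i hi
    rw [if_pos (h hi), one_pow]
  · obtain ⟨i, hi, his⟩ := Finset.not_subset.mp h
    rw [Finset.prod_eq_zero hi, zero_mul]
    rw [if_neg his, zero_pow (Finsupp.mem_support_iff.mp hi)]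

/-- A monomial involves finitely many variables, so its coefficient survives restriction to its own
support. -/
theorem ext_restrictVars {f g : PowerSeries (MvPowerSeries ℕ+ ℚ[X])}
    (h : ∀ s, PowerSeries.map (restrictVars s) f = PowerSeries.map (restrictVars s) g) :
    f = g := by
  ext n m : 2
  have := congrArg (fun p => MvPowerSeries.coeff m (PowerSeries.coeff n p)) (h m.support)
  simpa [PowerSeries.coeff_map, coeff_restrictVars] using this

theorem restrictVars_tVar (s : Finset ℕ+) : restrictVars s tVar = tVar := by
  classical
  ext1 m
  rw [coeff_restrictVars, tVar, MvPowerSeries.coeff_C]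
  by_cases h : m = 0 <;> simp [h]

theorem restrictVars_tInt (s : Finset ℕ+) (n : ℕ) : restrictVars s (tInt n) = tInt n := by
  simp [tInt, restrictVars_tVar]

theorem tVar_sub_one_mul_tInt (n : ℕ) : (tVar - 1) * tInt n = tVar ^ n - 1 := mul_geom_sum _ _

theorem tVar_ne_one : tVar ≠ 1 := by
  intro h
  have := MvPowerSeries.C_injective (h.trans (map_one MvPowerSeries.C).symm)
  simpa [Polynomial.coeff_one] using congrArg (Polynomial.coeff · 1) this

theorem prod_X_eq_monomial {V : Type*} (S : Finset V) (κ : V → ℕ+) :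
    ∏ i ∈ S, (MvPowerSeries.X (κ i) : MvPowerSeries ℕ+ ℚ[X]) =
      MvPowerSeries.monomial (∑ i ∈ S, Finsupp.single (κ i) 1) 1 := by
  classical
  induction S using Finset.induction_on with
  | empty => simp
  | insert a S ha ih =>
    rw [Finset.prod_insert ha, Finset.sum_insert ha, ih, MvPowerSeries.X,
      MvPowerSeries.monomial_mul_monomial, one_mul]

theorem support_sum_single (S : Finset ℕ+) :
    (∑ i ∈ S, Finsupp.single i 1 : ℕ+ →₀ ℕ).support = S := by
  ext j
  simp [Finsupp.finsetSum_apply, Finsupp.single_apply]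

theorem restrictVars_esymm (s : Finset ℕ+) (k : ℕ) :
    restrictVars s (esymm k) = ∑ S ∈ s.powersetCard k, ∏ i ∈ S, MvPowerSeries.X i := by
  classical
  ext1 m
  rw [coeff_restrictVars, map_sum, MvPowerSeries.coeff_apply, esymm]
  simp only [prod_X_eq_monomial _ (fun i : ℕ+ => i), MvPowerSeries.coeff_monomial]
  by_cases h : ∃ S : Finset ℕ+, S.card = k ∧ m = ∑ i ∈ S, Finsupp.single i 1
  · rw [if_pos h]
    obtain ⟨S, hS, rfl⟩ := h
    have (T : Finset ℕ+) : (∑ i ∈ S, Finsupp.single i 1 : ℕ+ →₀ ℕ) =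
        ∑ i ∈ T, Finsupp.single i 1 ↔ S = T :=
      ⟨fun h => by simpa only [support_sum_single] using congrArg Finsupp.support h,
        fun h => h ▸ rfl⟩
    simp [this, support_sum_single, Finset.mem_powersetCard, hS]
  · rw [if_neg h, ite_self, Finset.sum_eq_zero]
    intro S hS
    rw [if_neg]
    exact fun hm => h ⟨S, (Finset.mem_powersetCard.mp hS).2, hm⟩

/-! ### Colorings of the cycle as closed walks -/

/-- Addition in `Fin` wraps around, which absorbs the closing edge. -/
theorem directedCycle_adj_iff (n : ℕ) (i j : Fin (n + 2)) :
    (directedCycle (n + 2)).Adj i j ↔ j = i + 1 := by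
  change (i.val + 1 = j.val ∨ (i.val + 1 = n + 2 ∧ j.val = 0)) ↔ _
  rw [Fin.ext_iff, Fin.val_add_one]
  split_ifs with h
  · have := j.isLt
    rw [h, Fin.val_last]
    omega
  · have : i.val ≠ n + 1 := fun h' => h (Fin.ext h')
    omega

theorem isProper_directedCycle (n : ℕ) (κ : Fin (n + 2) → ℕ+) :
    IsProper (directedCycle (n + 2)) κ ↔ ∀ i, κ i ≠ κ (i + 1) := by
  simp only [IsProper, Digraph.toSimpleGraphInclusive, SimpleGraph.fromRel_adj,
    directedCycle_adj_iff]
  constructor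
  · intro h i
    exact h i (i + 1) ⟨by simp, Or.inl rfl⟩
  · rintro h u v ⟨-, rfl | rfl⟩
    · exact h u
    · exact (h v).symm

theorem asc_directedCycle (n : ℕ) (κ : Fin (n + 2) → ℕ+) :
    asc (directedCycle (n + 2)) κ = (Finset.univ.filter fun i => κ i < κ (i + 1)).card := by
  classical
  rw [asc]
  symm
  refine Finset.card_bij (fun i _ => (i, i + 1)) ?_ ?_ ?_
  · intro i hi
    simpa [directedCycle_adj_iff] using hi
  · intro i _ j _ h
    exact congrArg Prod.fst h
  · rintro ⟨i, j⟩ h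
    simp only [directedCycle_adj_iff, Finset.mem_filter, Finset.mem_univ, true_and] at h
    obtain ⟨rfl, h⟩ := h
    exact ⟨i, by simpa using h, rfl⟩

open Classical in
theorem prod_ascMatrix (s : Finset ℕ+) (n : ℕ) (κ : Fin (n + 2) → s) :
    ∏ i, ascMatrix tVar (fun j : s => MvPowerSeries.X j.1) (κ i) (κ (i + 1)) =
      MvPowerSeries.monomial (monoExp fun i => (κ i).1)
        (if IsProper (directedCycle (n + 2)) (fun i => (κ i).1) then
          (X : ℚ[X]) ^ asc (directedCycle (n + 2)) (fun i => (κ i).1) else 0) := by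
  simp only [ascMatrix, Matrix.of_apply, Finset.prod_mul_distrib]
  -- Each edge carries the variable of its head, and every vertex is the head of exactly one edge.
  have hX : ∏ i, (MvPowerSeries.X (κ (i + 1)).1 : MvPowerSeries ℕ+ ℚ[X]) =
      ∏ i, MvPowerSeries.X (κ i).1 :=
    Fintype.prod_equiv (Equiv.addRight (1 : Fin (n + 2))) _ _ fun _ => rfl
  rw [hX, prod_X_eq_monomial _ fun i => (κ i).1]
  have : ∏ i, (if κ i < κ (i + 1) then tVar else if κ (i + 1) < κ i then 1 else 0) =
      MvPowerSeries.monomial (0 : ℕ+ →₀ ℕ)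
        (if IsProper (directedCycle (n + 2)) (fun i => (κ i).1) then
          (X : ℚ[X]) ^ asc (directedCycle (n + 2)) (fun i => (κ i).1) else 0) := by
    rw [isProper_directedCycle, asc_directedCycle]
    split_ifs with h
    · rw [MvPowerSeries.monomial_zero_eq_C_apply, map_pow, ← tVar, ← Finset.prod_const,
        Finset.prod_filter]
      refine Finset.prod_congr rfl fun i _ => ?_
      rcases lt_or_gt_of_ne (h i) with h1 | h1
      · rw [if_pos h1, if_pos (show κ i < κ (i + 1) from h1)]
      · rw [if_neg h1.not_gt, if_neg (show ¬ κ i < κ (i + 1) from h1.not_gt),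
          if_pos (show κ (i + 1) < κ i from h1)]
    · push Not at h
      obtain ⟨i, hi⟩ := h
      rw [map_zero, Finset.prod_eq_zero (Finset.mem_univ i)]
      rw [← Subtype.ext hi]
      simp
  rw [this, MvPowerSeries.monomial_mul_monomial, add_zero, one_mul, monoExp]

theorem mem_support_monoExp {V : Type} [Fintype V] (κ : V → ℕ+) (j : ℕ+) :
    j ∈ (monoExp κ).support ↔ ∃ v, κ v = j := by
  simp [monoExp, Finsupp.finsetSum_apply, Finsupp.single_apply]

theorem restrictVars_chromQSym_directedCycle (s : Finset ℕ+) (n : ℕ) :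
    restrictVars s (chromQSym (directedCycle (n + 2))) =
      (ascMatrix tVar (fun j : s => MvPowerSeries.X j.1) ^ (n + 2)).trace := by
  classical
  rw [trace_pow_eq_sum_closed_walks]
  simp only [prod_ascMatrix]
  ext1 m
  rw [coeff_restrictVars, map_sum, MvPowerSeries.coeff_apply, chromQSym]
  simp only [MvPowerSeries.coeff_monomial, ← ite_and]
  split_ifs with h
  · rw [← Finset.sum_filter]
    symm
    refine Finset.sum_bij (fun κ _ i => (κ i).1) ?_ ?_ ?_ ?_
    · intro κ hκ
      rw [Finset.mem_filter] at hκ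
      exact (mem_properColorings _ _ _).2 ⟨hκ.2.2, hκ.2.1.symm⟩
    · intro κ _ κ' _ hκ
      funext i
      exact Subtype.ext (congrFun hκ i)
    · intro κ hκ
      rw [mem_properColorings] at hκ
      have hmem (i) : κ i ∈ m.support := by
        rw [← hκ.2, mem_support_monoExp]
        exact ⟨i, rfl⟩
      exact ⟨fun i => ⟨κ i, h (hmem i)⟩, by simpa using ⟨hκ.2.symm, hκ.1⟩, rfl⟩
    · intro κ _
      rfl
  · rw [Finset.sum_eq_zero]
    intro κ _
    rw [if_neg]
    rintro ⟨rfl, -⟩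
    refine h fun j hj => ?_
    obtain ⟨i, rfl⟩ := (mem_support_monoExp _ _).1 hj
    exact (κ i).2

/-! ### Matching both sides after restriction -/

theorem coeff_genFrom2 (a : ℕ → MvPowerSeries ℕ+ ℚ[X]) (n : ℕ) :
    PowerSeries.coeff n (genFrom2 a) = if 2 ≤ n then a n else 0 := by
  rw [genFrom2, PowerSeries.coeff_mk]

theorem map_restrictVars_denominator (s : Finset ℕ+) :
    PowerSeries.map (restrictVars s)
      (1 - PowerSeries.C tVar * genFrom2 fun k => tInt (k - 1) * esymm k) =
      (oneSubXSmul (ascMatrix tVar fun j : s => MvPowerSeries.X j.1)).det := by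
  have hne : (PowerSeries.C tVar - 1 : PowerSeries (MvPowerSeries ℕ+ ℚ[X])) ≠ 0 := fun h =>
    tVar_ne_one (PowerSeries.C_injective ((sub_eq_zero.mp h).trans (map_one _).symm))
  -- Multiplying by `t - 1` turns `[k - 1]_t` into `t ^ (k - 1) - 1`.
  refine mul_left_cancel₀ hne ?_
  rw [sub_one_mul_det_ascMatrix]
  have h1 := s.prod_coe_sort fun j : ℕ+ =>
    (1 + PowerSeries.C (1 * MvPowerSeries.X j : MvPowerSeries ℕ+ ℚ[X]) * PowerSeries.X)
  have h2 := s.prod_coe_sort fun j : ℕ+ =>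
    (1 + PowerSeries.C (tVar * MvPowerSeries.X j : MvPowerSeries ℕ+ ℚ[X]) * PowerSeries.X)
  simp only [one_mul] at h1
  rw [h1, h2]
  ext1 k
  have e1 := coeff_prod_one_add_C_mul_X s 1
    (MvPowerSeries.X : ℕ+ → MvPowerSeries ℕ+ ℚ[X]) k
  simp only [one_mul, one_pow] at e1
  have hC : (PowerSeries.C tVar - 1 : PowerSeries (MvPowerSeries ℕ+ ℚ[X])) =
      PowerSeries.C (tVar - 1) := by rw [map_sub, map_one]
  rw [hC, PowerSeries.coeff_C_mul, PowerSeries.coeff_map, map_sub (PowerSeries.coeff k),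
    map_sub (PowerSeries.coeff k), PowerSeries.coeff_C_mul, PowerSeries.coeff_C_mul, e1,
    coeff_prod_one_add_C_mul_X, coeff_genFrom2, ← restrictVars_esymm]
  -- Degree 0 gives `t - 1`; in degree 1 the terms `t e_1` cancel, which is why the sum starts at 2.
  match k with
  | 0 => simp [restrictVars_esymm]
  | 1 => simp [PowerSeries.coeff_one]
  | k + 2 =>
    have h := tVar_sub_one_mul_tInt (k + 1)
    simp only [PowerSeries.coeff_one, map_sub, map_mul, restrictVars_tVar, restrictVars_tInt,
      if_pos (Nat.le_add_left 2 k), show k + 2 - 1 = k + 1 from rfl]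
    simp only [Nat.add_eq_zero_iff, OfNat.ofNat_ne_zero, and_false, if_false, map_zero]
    linear_combination (-tVar * restrictVars s (esymm (k + 2))) * h

/-- The operator `-z d/dz` multiplies the `z ^ k` coefficient `-t [k - 1]_t e_k` by `-k`. -/
theorem map_restrictVars_numerator (s : Finset ℕ+) :
    PowerSeries.map (restrictVars s) (PowerSeries.C tVar * genFrom2 fun k =>
      (k : MvPowerSeries ℕ+ ℚ[X]) * tInt (k - 1) * esymm k) =
      -(PowerSeries.X * PowerSeries.derivative _
        (oneSubXSmul (ascMatrix tVar fun j : s => MvPowerSeries.X j.1)).det) := by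
  rw [← map_restrictVars_denominator]
  ext1 k
  cases k with
  | zero => simp [coeff_genFrom2]
  | succ k =>
    rw [map_neg, PowerSeries.coeff_succ_X_mul, PowerSeries.coeff_derivative]
    rw [PowerSeries.coeff_map, PowerSeries.coeff_map, map_sub, PowerSeries.coeff_C_mul,
      PowerSeries.coeff_C_mul, coeff_genFrom2, coeff_genFrom2, PowerSeries.coeff_one,
      if_neg k.succ_ne_zero]
    split_ifs
    · simp only [map_sub, map_mul, map_zero, map_natCast, map_add, map_one, Nat.cast_add,
        Nat.cast_one]
      ring
    · simp

theorem map_restrictVars_chromQSym (s : Finset ℕ+) :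
    PowerSeries.map (restrictVars s) (genFrom2 fun n => chromQSym (directedCycle n)) =
      PowerSeries.mk fun n => if n = 0 then 0 else
        (ascMatrix tVar (fun j : s => MvPowerSeries.X j.1) ^ n).trace := by
  ext1 n
  rw [PowerSeries.coeff_map, coeff_genFrom2, PowerSeries.coeff_mk]
  match n with
  | 0 => simp
  -- The zero diagonal makes the trace vanish.
  | 1 => simp [Matrix.trace, ascMatrix]
  | n + 2 => simpa using restrictVars_chromQSym_directedCycle s n

end ChromQSym

theorem theorem6p1 :
    IsUnit (1 - PowerSeries.C ChromQSym.tVar *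
      ChromQSym.genFrom2 fun k => ChromQSym.tInt (k - 1) * ChromQSym.esymm k) ∧
    (ChromQSym.genFrom2 fun n => ChromQSym.chromQSym (ChromQSym.directedCycle n)) =
      (PowerSeries.C ChromQSym.tVar * ChromQSym.genFrom2 fun k =>
          (k : MvPowerSeries ℕ+ ℚ[X]) * ChromQSym.tInt (k - 1) * ChromQSym.esymm k) *
        Ring.inverse (1 - PowerSeries.C ChromQSym.tVar *
          ChromQSym.genFrom2 fun k => ChromQSym.tInt (k - 1) * ChromQSym.esymm k) := by
  have hU : IsUnit (1 - PowerSeries.C ChromQSym.tVar *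
      ChromQSym.genFrom2 fun k => ChromQSym.tInt (k - 1) * ChromQSym.esymm k) := by
    rw [PowerSeries.isUnit_iff_constantCoeff]
    have : PowerSeries.constantCoeff
        (ChromQSym.genFrom2 fun k => ChromQSym.tInt (k - 1) * ChromQSym.esymm k) = 0 := by
      rw [← PowerSeries.coeff_zero_eq_constantCoeff_apply, ChromQSym.coeff_genFrom2]
      simp
    simp [this]
  refine ⟨hU, (Ring.eq_mul_inverse_iff_mul_eq _ _ _ hU).2 (ChromQSym.ext_restrictVars fun s => ?_)⟩
  rw [map_mul, ChromQSym.map_restrictVars_chromQSym, ChromQSym.map_restrictVars_denominator,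
    ChromQSym.map_restrictVars_numerator, mk_trace_pow_mul_det]
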